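/- There is an absolute constant $C>0$ such that for every finite simple undirected graph $G=(V,E)$ with $n\ge 2$ vertices, $$\operatorname{xc}(\mathrm{COR}(G))\;\le\;2^{\,C\,(\mathrm{tw}(G)+\log_2 n)} ,$$ that is, the extension complexity of $\mathrm{COR}(G)$ is $2^{O(\mathrm{tw}(G)+\log n)}$. Here the correlation polytope $\mathrm{COR}(G)\subseteq\mathbb{R}^{V\cup E}$ is the convex hull of the vectors $(\chi(X),\chi(E(X)))$ for $X\subseteq V$, where $E(X)$ is the set of edges with both endpoints in $X$ and $\chi$ denotes the characteristic vector of a set. The extension complexity $\operatorname{xc}(P)$ of a polytope $P\subseteq\mathbb{R}^d$ is the minimum number of facets of a polytope $Q\subseteq\mathbb{R}^p$ ($p$ arbitrary) for which there is an affine map $\pi:\mathbb{R}^p\to\mathbb{R}^d$ with $\pi(Q)=P$. The treewidth $\mathrm{tw}(G)$ is the minimum of $\max_{t}(|B_t|-1)$ over all tree-decompositions of $G$, i.e. over all pairs of a finite tree $T$ and sets $B_t\subseteq V$ ($t\in V(T)$) such that every vertex lies in some $B_t$, both endpoints of every edge lie in a common $B_t$, and for every $v\in V$ the set $\{t : v\in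 B_t\}$ induces a (nonempty) subtree of $T$. -/

import Mathlib

/-! ### Polytopes, facets and extension complexity -/

/-- A polytope: the convex hull of finitely many points. -/
def IsPolytope {E : Type*} [AddCommGroup E] [Module ℝ E] (P : Set E) : Prop :=
  ∃ S : Set E, S.Finite ∧ P = convexHull ℝ S

/-- A facet of `Q`: an inclusion-wise maximal face among the nonempty faces different from `Q`.
A nonempty face of a polytope is the set of points at which some linear functional attains its
maximum over the polytope, that is, a nonempty exposed subset. -/
def IsFacet {E : Type*} [TopologicalSpace E] [AddCommGroup E] [Module ℝ E] (Q F : Set E) : Prop :=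
  Maximal (fun F' : Set E => IsExposed ℝ Q F' ∧ F'.Nonempty ∧ F' ≠ Q) F

/-- The polytope `Q ⊆ ℝ^p` is an extension of `P`: some affine map sends `Q` onto `P`. -/
def IsExtension {p : ℕ} {E : Type*} [AddCommGroup E] [Module ℝ E]
    (Q : Set (Fin p → ℝ)) (P : Set E) : Prop :=
  IsPolytope Q ∧ ∃ π : (Fin p → ℝ) →ᵃ[ℝ] E, π '' Q = P

/-- The extension complexity of `P`: the minimum number of facets of any extension of `P`.
The value lies in `ℕ∞`, and it is `⊤` if there is no extension with finitely many facets. -/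
noncomputable def extensionComplexity {E : Type*} [AddCommGroup E] [Module ℝ E]
    (P : Set E) : ℕ∞ :=
  sInf {k : ℕ∞ | ∃ (p : ℕ) (Q : Set (Fin p → ℝ)),
    IsExtension Q P ∧ k = {F : Set (Fin p → ℝ) | IsFacet Q F}.encard}

/-! ### The correlation polytope -/

/-- `E(X)`: the set of edges of `G` with both endpoints in `X`. -/
def edgesInside {V : Type*} (G : SimpleGraph V) (X : Set V) : Set G.edgeSet :=
  {e | ∀ v ∈ (e : Sym2 V), v ∈ X}

/-- The vector `(χ(X), χ(E(X)))` in `ℝ^(V ∪ E)`. -/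
noncomputable def corVector {V : Type*} (G : SimpleGraph V) (X : Set V) : V ⊕ G.edgeSet → ℝ :=
  Sum.elim (X.indicator 1) ((edgesInside G X).indicator 1)

/-- The correlation polytope of `G`. -/
noncomputable def correlationPolytope {V : Type*} (G : SimpleGraph V) :
    Set (V ⊕ G.edgeSet → ℝ) :=
  convexHull ℝ (Set.range (corVector G))

/-! ### Treewidth -/

/-- A tree-decomposition of a graph (with a finite tree and finite bags). -/
structure TreeDecomposition {V : Type*} (G : SimpleGraph V) where
  /-- The nodes of the tree. -/
  node : Type
  /-- The tree is finite. -/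
  fintypeNode : Fintype node
  /-- The tree. -/
  tree : SimpleGraph node
  isTree : tree.IsTree
  /-- The bags. -/
  bag : node → Finset V
  vertex_mem_bag : ∀ v : V, ∃ t, v ∈ bag t
  edge_mem_bag : ∀ u v : V, G.Adj u v → ∃ t, u ∈ bag t ∧ v ∈ bag t
  subtree : ∀ v : V, (tree.induce {t | v ∈ bag t}).Connected

/-- The width of a tree-decomposition: the maximum of `|B_t| - 1` over the nodes `t`. If `G` has a
vertex, then some bag is nonempty and the truncated subtraction does not change the maximum. -/
def TreeDecomposition.width {V : Type*} {G : SimpleGraph V} (D : TreeDecomposition G) : ℕ :=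
  (@Finset.univ D.node D.fintypeNode).sup fun t => (D.bag t).card - 1

/-- The treewidth of a finite graph: the minimum width of a tree-decomposition. The minimum is
over a nonempty set, as the tree with one node and the bag `V` gives a tree-decomposition. -/
noncomputable def treewidth {V : Type*} [Finite V] (G : SimpleGraph V) : ℕ :=
  sInf {w : ℕ | ∃ D : TreeDecomposition G, D.width = w}

/-! ### Counting facets by coordinate hyperplanes -/

section Facets

/-! A point of COR(G) records the probabilities that a random vertex set contains given vertices and
edges. Each such event is decided inside one bag of a tree-decomposition, so it suffices to keep the
distribution of the trace on each bag: variables `x B A` for `A ⊆ B`, nonnegative, of total mass 1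
for each bag, with equal marginals on pairwise intersections of bags.

Such local data always come from a global distribution: adding the bags one at a time, the new bag
is glued conditionally independently over its overlap with the earlier ones
(`RunningIntersection.exists_measure`). Hence the local polytope is the hull of the traces and
projects linearly onto COR(G). Its only inequalities are nonnegativity of coordinates, so it has at
most one facet per variable. Pruning to at most n + 1 bags leaves at most (n + 1) 2^(tw + 1)
variables. -/

/-- A nonnegative convex set, closed under extending segments as long as coordinates stay
nonnegative, has its facets among the sets `{x ∈ Q | x i = 0}`. -/
theorem IsFacet.exists_coordinate {ι : Type*} [Fintype ι] {Q F : Set (ι → ℝ)}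
    (hconv : Convex ℝ Q) (hnonneg : ∀ x ∈ Q, ∀ i, 0 ≤ x i)
    (hext : ∀ x ∈ Q, ∀ y ∈ Q, ∀ c : ℝ, (∀ i, 0 ≤ x i + c * (x i - y i)) → x + c • (x - y) ∈ Q)
    (hF : IsFacet Q F) : ∃ i, {x ∈ Q | x i = 0} = F := by
  classical
  obtain ⟨⟨hexp, hne, hneq⟩, hmax⟩ := hF
  have hFconv : Convex ℝ F := hexp.convex hconv
  obtain ⟨l, hl⟩ := hexp hne
  have hFQ : F ⊆ Q := hexp.subset
  -- Averaging points of `F` yields one point positive in every coordinate that is not identically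
  -- zero on `F`.
  have hgen : ∀ s : Finset ι, ∃ x ∈ F, ∀ i ∈ s, (∃ y ∈ F, 0 < y i) → 0 < x i := by
    intro s
    induction s using Finset.induction_on with
    | empty => exact ⟨hne.some, hne.some_mem, by simp⟩
    | insert j s hj ih =>
      obtain ⟨x, hx, hxs⟩ := ih
      by_cases hy : ∃ y ∈ F, 0 < y j
      · obtain ⟨y, hyF, hyj⟩ := hy
        refine ⟨(1 / 2 : ℝ) • x + (1 / 2 : ℝ) • y,
          hFconv hx hyF (by norm_num) (by norm_num) (by norm_num), fun i hi hpos => ?_⟩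
        have h1 := hnonneg x (hFQ hx) i
        have h2 := hnonneg y (hFQ hyF) i
        simp only [Pi.add_apply, Pi.smul_apply, smul_eq_mul]
        rcases Finset.mem_insert.1 hi with rfl | hi
        · linarith
        · linarith [hxs i hi hpos]
      · refine ⟨x, hx, fun i hi hpos => ?_⟩
        rcases Finset.mem_insert.1 hi with rfl | hi
        · exact absurd hpos hy
        · exact hxs i hi hpos
  obtain ⟨x, hxF, hx⟩ := hgen Finset.univ
  obtain ⟨y, hyQ, hyF⟩ : ∃ y ∈ Q, y ∉ F := by
    by_contra! h
    exact hneq (hFQ.antisymm h)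
  have hxl : ∀ z ∈ Q, l z ≤ l x := by
    rw [hl] at hxF
    exact hxF.2
  have hlt : l y < l x := by
    refine lt_of_le_of_ne (hxl y hyQ) fun h => hyF ?_
    rw [hl]
    exact ⟨hyQ, fun z hz => h ▸ hxl z hz⟩
  -- Otherwise `x` can be pushed slightly away from `y` without leaving `Q`, which raises `l` above
  -- its maximum.
  obtain ⟨i, hiF, hyi⟩ : ∃ i, (∀ z ∈ F, z i = 0) ∧ 0 < y i := by
    by_contra! hcon
    have hev : ∀ᶠ c : ℝ in nhdsWithin 0 (Set.Ioi 0), ∀ i, c * y i ≤ x i := by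
      rw [Filter.eventually_all]
      intro i
      rcases (hnonneg x (hFQ hxF) i).lt_or_eq with hpos | hzero
      · have : Filter.Tendsto (fun c : ℝ => c * y i) (nhdsWithin 0 (Set.Ioi 0)) (nhds 0) := by
          have h : Filter.Tendsto (fun c : ℝ => c * y i) (nhds 0) (nhds (0 * y i)) :=
            (continuous_id.mul continuous_const).tendsto 0
          rw [zero_mul] at h
          exact h.mono_left nhdsWithin_le_nhds
        exact (this.eventually (gt_mem_nhds hpos)).mono fun c hc => hc.le
      · have hyi : y i ≤ 0 := hcon i fun z hz => by
          by_contra hz0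
          have := hx i (Finset.mem_univ i)
            ⟨z, hz, lt_of_le_of_ne (hnonneg z (hFQ hz) i) (Ne.symm hz0)⟩
          linarith
        filter_upwards [self_mem_nhdsWithin] with c hc
        have hc' : (0 : ℝ) < c := hc
        nlinarith
    obtain ⟨c, hc, hc0⟩ := (hev.and self_mem_nhdsWithin).exists
    have hc0' : (0 : ℝ) < c := hc0
    have hmem := hext x (hFQ hxF) y hyQ c fun i => by
      have h1 := hnonneg x (hFQ hxF) i
      have h2 := hc i
      nlinarith
    have := hxl _ hmem
    simp only [map_add, map_smul, map_sub, smul_eq_mul] at this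
    nlinarith
  refine ⟨i, Set.Subset.antisymm (hmax ⟨fun _ => ?_, ?_, ?_⟩ ?_) ?_⟩
  · refine ⟨-(ContinuousLinearMap.proj i : (ι → ℝ) →L[ℝ] ℝ), ?_⟩
    ext z
    simp only [Set.mem_ofPred_eq, neg_apply, ContinuousLinearMap.proj_apply,
      neg_le_neg_iff]
    refine and_congr_right fun hz => ⟨fun h w hw => h ▸ hnonneg w hw i, fun h => ?_⟩
    exact le_antisymm (hiF x hxF ▸ h x (hFQ hxF)) (hnonneg z hz i)
  · exact ⟨x, hFQ hxF, hiF x hxF⟩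
  · intro h
    rw [← h] at hyQ
    exact hyi.ne' hyQ.2
  · exact fun z hz => ⟨hFQ hz, hiF z hz⟩
  · exact fun z hz => ⟨hFQ hz, hiF z hz⟩

theorem encard_facets_le {ι : Type*} [Fintype ι] {Q : Set (ι → ℝ)}
    (hconv : Convex ℝ Q) (hnonneg : ∀ x ∈ Q, ∀ i, 0 ≤ x i)
    (hext : ∀ x ∈ Q, ∀ y ∈ Q, ∀ c : ℝ, (∀ i, 0 ≤ x i + c * (x i - y i)) → x + c • (x - y) ∈ Q) :
    {F : Set (ι → ℝ) | IsFacet Q F}.encard ≤ Fintype.card ι := by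
  calc {F : Set (ι → ℝ) | IsFacet Q F}.encard
      ≤ ((fun i => {x ∈ Q | x i = 0}) '' (Set.univ : Set ι)).encard :=
        Set.encard_le_encard fun F hF => by
          obtain ⟨i, hi⟩ := IsFacet.exists_coordinate hconv hnonneg hext hF
          exact ⟨i, trivial, hi⟩
    _ ≤ (Set.univ : Set ι).encard := Set.encard_image_le _ _
    _ = Fintype.card ι := by simp

end Facets

/-! ### Gluing consistent local distributions -/

section Gluing

/-- Two finite measures with the same image under `f` and `h` have a coupling on which `f` and `h`
agree. -/
theorem exists_coupling {α β γ : Type*} [Fintype α] [Fintype β] [DecidableEq γ]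
    {μ : α → ℝ} {ν : β → ℝ} {f : α → γ} {h : β → γ} (hμ : ∀ a, 0 ≤ μ a) (hν : ∀ b, 0 ≤ ν b)
    (heq : ∀ c, ∑ a, (if f a = c then μ a else 0) = ∑ b, if h b = c then ν b else 0) :
    ∃ g : α → β → ℝ, (∀ a b, 0 ≤ g a b) ∧ (∀ a, ∑ b, g a b = μ a) ∧ (∀ b, ∑ a, g a b = ν b) ∧
      ∀ a b, g a b ≠ 0 → f a = h b ∧ ν b ≠ 0 := by
  set m : γ → ℝ := fun c => ∑ b, if h b = c then ν b else 0 with hm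
  have hm0 : ∀ c, 0 ≤ m c := fun c => Finset.sum_nonneg fun b _ => by
    split_ifs
    exacts [hν b, le_rfl]
  have hμ0 : ∀ a, m (f a) = 0 → μ a = 0 := fun a ha => by
    have h1 := heq (f a)
    rw [show ∑ b, (if h b = f a then ν b else 0) = 0 from ha,
      Finset.sum_eq_zero_iff_of_nonneg fun a' _ => by
        split_ifs
        exacts [hμ a', le_rfl]] at h1
    simpa using h1 a (Finset.mem_univ a)
  have hν0 : ∀ b, m (h b) = 0 → ν b = 0 := fun b hb => by
    have h1 : ∑ b', (if h b' = h b then ν b' else 0) = 0 := hb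
    rw [Finset.sum_eq_zero_iff_of_nonneg fun b' _ => by
        split_ifs
        exacts [hν b', le_rfl]] at h1
    simpa using h1 b (Finset.mem_univ b)
  -- Conditionally independent coupling given the common value. Where `m` vanishes so do `μ` and
  -- `ν`, so division by zero giving 0 is harmless.
  refine ⟨fun a b => if f a = h b then μ a * ν b / m (f a) else 0, ?_, ?_, ?_, ?_⟩
  · intro a b
    dsimp only
    split_ifs
    exacts [div_nonneg (mul_nonneg (hμ a) (hν b)) (hm0 _), le_rfl]
  · intro a
    have : ∀ b, (if f a = h b then μ a * ν b / m (f a) else 0)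
        = μ a / m (f a) * (if h b = f a then ν b else 0) := fun b => by
      by_cases hab : f a = h b
      · rw [if_pos hab, if_pos hab.symm]
        ring
      · rw [if_neg hab, if_neg (Ne.symm hab), mul_zero]
    simp only [this]
    rw [← Finset.mul_sum]
    change μ a / m (f a) * m (f a) = μ a
    by_cases h0 : m (f a) = 0
    · rw [h0, hμ0 a h0]
      simp
    · exact div_mul_cancel₀ _ h0
  · intro b
    have : ∀ a, (if f a = h b then μ a * ν b / m (f a) else 0)
        = ν b / m (h b) * (if f a = h b then μ a else 0) := fun a => by
      by_cases hab : f a = h b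
      · rw [if_pos hab, if_pos hab, hab]
        ring
      · rw [if_neg hab, if_neg hab, mul_zero]
    simp only [this]
    rw [← Finset.mul_sum, heq]
    change ν b / m (h b) * m (h b) = ν b
    by_cases h0 : m (h b) = 0
    · rw [h0, hν0 b h0]
      simp
    · exact div_mul_cancel₀ _ h0
  · intro a b hab
    dsimp only at hab
    split_ifs at hab with h1
    · refine ⟨h1, fun h2 => hab ?_⟩
      rw [h2]
      simp
    · exact absurd rfl hab

variable {V : Type*} [DecidableEq V]

/-- The running intersection property of a nonempty finite family of finite sets. -/
inductive RunningIntersection : Finset (Finset V) → Prop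
  | single (B : Finset V) : RunningIntersection {B}
  | insert (B : Finset V) (𝓑 : Finset (Finset V)) : RunningIntersection 𝓑 →
      (∃ B' ∈ 𝓑, ∀ D ∈ 𝓑, B ∩ D ⊆ B') → RunningIntersection (insert B 𝓑)

variable [Fintype V]

/-- Local marginals that agree on pairwise intersections of the members of a family with the
running intersection property are the marginals of a measure on all subsets. -/
theorem RunningIntersection.exists_measure {𝓑 : Finset (Finset V)} (h𝓑 : RunningIntersection 𝓑)
    (x : Finset V → Finset V → ℝ) (hx : ∀ B A, 0 ≤ x B A) (hsupp : ∀ B A, x B A ≠ 0 → A ⊆ B)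
    (hcons : ∀ B ∈ 𝓑, ∀ B' ∈ 𝓑, ∀ a, ∑ A, (if A ∩ (B ∩ B') = a then x B A else 0)
      = ∑ A, if A ∩ (B ∩ B') = a then x B' A else 0) :
    ∃ μ : Finset V → ℝ, (∀ X, 0 ≤ μ X) ∧
      ∀ B ∈ 𝓑, ∀ A, ∑ X, (if X ∩ B = A then μ X else 0) = x B A := by
  induction h𝓑 with
  | single B =>
    refine ⟨x B, hx B, fun D hD A => ?_⟩
    obtain rfl := Finset.mem_singleton.1 hD
    rw [Finset.sum_eq_single A]
    · by_cases hA : x D A = 0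
      · simp [hA]
      · rw [if_pos (Finset.inter_eq_left.2 (hsupp D A hA))]
    · intro X _ hXA
      by_cases hX : x D X = 0
      · simp [hX]
      · rw [if_neg]
        rwa [Finset.inter_eq_left.2 (hsupp D X hX)]
    · simp
  | insert B 𝓑 _ hB ih =>
    obtain ⟨μ, hμ, hμm⟩ := ih fun D hD D' hD' =>
      hcons D (Finset.mem_insert_of_mem hD) D' (Finset.mem_insert_of_mem hD')
    obtain ⟨B', hB', hint⟩ := hB
    -- `B ∩ B'` lies in `B'`, so the marginal of `μ` there can be computed from `x B'`, and
    -- consistency turns it into that of `x B`.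
    have hmarg : ∀ a, ∑ X, (if X ∩ (B ∩ B') = a then μ X else 0)
        = ∑ A, if A ∩ (B ∩ B') = a then x B A else 0 := by
      intro a
      rw [hcons B (Finset.mem_insert_self _ _) B' (Finset.mem_insert_of_mem hB') a]
      simp only [← hμm B' hB', ← Finset.sum_filter]
      rw [← Finset.sum_fiberwise_of_maps_to
        (t := Finset.univ.filter fun A : Finset V => A ∩ (B ∩ B') = a) (g := fun X => X ∩ B')]
      · refine Finset.sum_congr rfl fun A hA => Finset.sum_congr ?_ fun _ _ => rfl
        have hA' := (Finset.mem_filter.1 hA).2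
        ext X
        simp only [Finset.mem_filter, Finset.mem_univ, true_and, and_iff_right_iff_imp]
        rintro rfl
        rw [← hA', Finset.inter_assoc]
        congr 1
        rw [Finset.inter_left_comm, Finset.inter_self]
      · intro X hX
        simp only [Finset.mem_filter, Finset.mem_univ, true_and] at hX ⊢
        rw [← hX, Finset.inter_assoc]
        congr 1
        rw [Finset.inter_left_comm, Finset.inter_self]
    obtain ⟨g, hg0, hgr, hgc, hgs⟩ := exists_coupling hμ (hx B) hmarg
    have hpush : ∀ D E : Finset V, ∑ Z, (if Z ∩ D = E then
        ∑ X, ∑ A, (if Z = X \ B ∪ A then g X A else 0) else 0)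
        = ∑ X, ∑ A, if (X \ B ∪ A) ∩ D = E then g X A else 0 := by
      intro D E
      have : ∀ Z : Finset V, (if Z ∩ D = E then
          ∑ X, ∑ A, (if Z = X \ B ∪ A then g X A else 0) else 0)
          = ∑ X, ∑ A, (if Z = X \ B ∪ A then (if (X \ B ∪ A) ∩ D = E then g X A else 0)
            else 0) := by
        intro Z
        by_cases hZ : Z ∩ D = E
        · rw [if_pos hZ]
          refine Finset.sum_congr rfl fun X _ => Finset.sum_congr rfl fun A _ => ?_
          by_cases h : Z = X \ B ∪ A
          · rw [if_pos h, if_pos h, ← h, if_pos hZ]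
          · rw [if_neg h, if_neg h]
        · rw [if_neg hZ]
          refine (Finset.sum_eq_zero fun X _ => Finset.sum_eq_zero fun A _ => ?_).symm
          by_cases h : Z = X \ B ∪ A
          · rw [if_pos h, ← h, if_neg hZ]
          · rw [if_neg h]
      simp only [this]
      rw [Finset.sum_comm]
      refine Finset.sum_congr rfl fun X _ => ?_
      rw [Finset.sum_comm]
      refine Finset.sum_congr rfl fun A _ => ?_
      simp
    -- The law of `X` with its trace on `B` replaced by `A`, where `(X, A)` has law `g`.
    refine ⟨fun Z => ∑ X, ∑ A, if Z = X \ B ∪ A then g X A else 0, fun Z => ?_, ?_⟩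
    · refine Finset.sum_nonneg fun X _ => Finset.sum_nonneg fun A _ => ?_
      split_ifs
      exacts [hg0 X A, le_rfl]
    · intro D hD E
      rw [hpush]
      rcases Finset.mem_insert.1 hD with rfl | hD
      · rw [Finset.sum_comm]
        have : ∀ A X : Finset V, (if (X \ D ∪ A) ∩ D = E then g X A else 0)
            = if A = E then g X A else 0 := by
          intro A X
          by_cases h0 : g X A = 0
          · simp [h0]
          · have hA := hsupp D A (hgs X A h0).2
            have : (X \ D ∪ A) ∩ D = A := by
              rw [Finset.union_inter_distrib_right, Finset.inter_eq_left.2 hA]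
              simp
            rw [this]
        simp only [this]
        rw [Finset.sum_eq_single E]
        · simp [hgc]
        · intro A _ hA
          simp [hA]
        · simp
      · rw [← hμm D hD E]
        refine Finset.sum_congr rfl fun X _ => ?_
        have : ∀ A : Finset V, (if (X \ B ∪ A) ∩ D = E then g X A else 0)
            = if X ∩ D = E then g X A else 0 := by
          intro A
          by_cases h0 : g X A = 0
          · simp [h0]
          · obtain ⟨hXA, hA⟩ := hgs X A h0
            have hA := hsupp B A hA
            -- The replacement is invisible on an old `D`: `B ∩ D ⊆ B'`, and `X` and `A` agree on `B
            -- ∩ B'`.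
            have : (X \ B ∪ A) ∩ D = X ∩ D := by
              ext v
              have h1 := Finset.ext_iff.1 hXA v
              have h2 := @hint D hD v
              have h3 := @hA v
              simp only [Finset.mem_inter, Finset.mem_union, Finset.mem_sdiff] at h1 h2 ⊢
              tauto
            rw [this]
        simp only [this]
        split_ifs
        · exact hgr X
        · simp

end Gluing

/-! ### Pruning a tree-decomposition -/

section Bags

/-- A finite tree-decomposition can be pruned to a family of at most `|V| + 1` bags with the running
intersection property. -/
theorem TreeDecomposition.exists_runningIntersection {V : Type*} [Fintype V] [DecidableEq V]
    {G : SimpleGraph V} (D : TreeDecomposition G) :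
    ∃ 𝓑 : Finset (Finset V), RunningIntersection 𝓑 ∧ 𝓑.card ≤ Fintype.card V + 1 ∧
      (∀ B ∈ 𝓑, ∃ t, D.bag t = B) ∧ ∀ t, ∃ B ∈ 𝓑, D.bag t ⊆ B := by
  classical
  let := D.fintypeNode
  -- A connected set of nodes is grown to a maximal one. Every bag kept after the first brings a new
  -- vertex, hence the bound by the size of the union plus one; the first bag may be empty.
  let Good : Finset D.node → Prop := fun P =>
    (P.Nonempty ∧ ∀ a ∈ P, ∀ b ∈ P, ∃ w : D.tree.Walk a b, ∀ c ∈ w.support, c ∈ P) ∧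
    ∃ 𝓑 : Finset (Finset V), RunningIntersection 𝓑 ∧ 𝓑.card ≤ (𝓑.sup id).card + 1 ∧
      (∀ B ∈ 𝓑, ∃ t ∈ P, D.bag t = B) ∧ ∀ t ∈ P, ∃ B ∈ 𝓑, D.bag t ⊆ B
  obtain ⟨r⟩ := D.isTree.1.nonempty
  have hr : Good {r} := by
    refine ⟨⟨by simp, ?_⟩, {D.bag r}, .single _, by simp, by simp, by simp⟩
    intro a ha b hb
    obtain rfl := Finset.mem_singleton.1 ha
    obtain rfl := Finset.mem_singleton.1 hb
    exact ⟨.nil, by simp⟩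
  obtain ⟨P, hP⟩ := (Set.toFinite {P | Good P}).exists_maximal ⟨_, hr⟩
  obtain ⟨⟨⟨⟨s, hs⟩, hconn⟩, 𝓑, hRI, hcard, hbag, hcov⟩, hmax⟩ := hP
  by_cases huniv : ∀ t, t ∈ P
  · refine ⟨𝓑, hRI, hcard.trans (by gcongr; exact Finset.card_le_univ _), fun B hB => ?_,
      fun t => hcov t (huniv t)⟩
    obtain ⟨t, -, ht⟩ := hbag B hB
    exact ⟨t, ht⟩
  exfalso
  push Not at huniv
  obtain ⟨q, hq⟩ := huniv
  obtain ⟨w⟩ := D.isTree.1.preconnected s q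
  obtain ⟨d, -, hp, ht⟩ := w.exists_boundary_dart (P : Set D.node) hs hq
  set p := d.fst
  set t := d.snd
  have hadj : D.tree.Adj p t := d.adj
  simp only [Finset.mem_coe] at hp ht
  -- A walk from `t` to `u` through bags containing `v`, then from `u` to `p` inside `P`, must cross
  -- the bridge `tp`. The second half avoids `t`, so the first visits `p`.
  have hsep : ∀ u ∈ P, D.bag t ∩ D.bag u ⊆ D.bag p := by
    intro u hu v hv
    obtain ⟨hvt, hvu⟩ := Finset.mem_inter.1 hv
    obtain ⟨w₁⟩ := (D.subtree v).preconnected ⟨t, hvt⟩ ⟨u, hvu⟩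
    obtain ⟨w₂, hw₂⟩ := hconn u hu p hp
    have hbr := SimpleGraph.isAcyclic_iff_forall_adj_isBridge.1 D.isTree.2 hadj.symm
    rw [SimpleGraph.isBridge_iff_forall_walk_mem_edges] at hbr
    let w₃ : D.tree.Walk t u := w₁.map (SimpleGraph.Embedding.induce _).toHom
    have hmem := hbr (w₃.append w₂)
    rw [SimpleGraph.Walk.edges_append, List.mem_append] at hmem
    rcases hmem with h | h
    · have : p ∈ (w₁.map (SimpleGraph.Embedding.induce _).toHom).support :=
        w₃.snd_mem_support_of_mem_edges h
      rw [SimpleGraph.Walk.support_map, List.mem_map] at this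
      obtain ⟨z, -, hz⟩ := this
      rw [← hz]
      exact z.2
    · exact absurd (hw₂ _ (w₂.fst_mem_support_of_mem_edges h)) ht
  have hconn' : (insert t P).Nonempty ∧ ∀ a ∈ insert t P, ∀ b ∈ insert t P,
      ∃ w : D.tree.Walk a b, ∀ c ∈ w.support, c ∈ insert t P := by
    have hto : ∀ a ∈ insert t P, ∃ w : D.tree.Walk a p, ∀ c ∈ w.support, c ∈ insert t P := by
      intro a ha
      rcases Finset.mem_insert.1 ha with rfl | ha
      · refine ⟨.cons hadj.symm .nil, fun c hc => ?_⟩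
        simp only [SimpleGraph.Walk.support_cons, SimpleGraph.Walk.support_nil,
          List.mem_cons, List.not_mem_nil, or_false] at hc
        rcases hc with rfl | rfl
        exacts [Finset.mem_insert_self _ _, Finset.mem_insert_of_mem hp]
      · obtain ⟨w, hw⟩ := hconn a ha p hp
        exact ⟨w, fun c hc => Finset.mem_insert_of_mem (hw c hc)⟩
    refine ⟨⟨t, Finset.mem_insert_self _ _⟩, fun a ha b hb => ?_⟩
    obtain ⟨w₁, hw₁⟩ := hto a ha
    obtain ⟨w₂, hw₂⟩ := hto b hb
    refine ⟨w₁.append w₂.reverse, fun c hc => ?_⟩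
    rw [SimpleGraph.Walk.mem_support_append_iff, SimpleGraph.Walk.support_reverse,
      List.mem_reverse] at hc
    exact hc.elim (hw₁ c) (hw₂ c)
  obtain ⟨B', hB', hpB'⟩ := hcov p hp
  have hint : ∀ E ∈ 𝓑, D.bag t ∩ E ⊆ B' := by
    intro E hE
    obtain ⟨u, hu, rfl⟩ := hbag E hE
    exact (hsep u hu).trans hpB'
  have hgood : Good (insert t P) := by
    refine ⟨hconn', ?_⟩
    -- A bag inside `B'` is dropped; any other has a vertex outside `B'`, which by `hint` lies in no
    -- earlier bag.
    by_cases hsub : D.bag t ⊆ B'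
    · refine ⟨𝓑, hRI, hcard, fun B hB => ?_, fun u hu => ?_⟩
      · obtain ⟨u, hu, rfl⟩ := hbag B hB
        exact ⟨u, Finset.mem_insert_of_mem hu, rfl⟩
      · rcases Finset.mem_insert.1 hu with rfl | hu
        exacts [⟨B', hB', hsub⟩, hcov u hu]
    · refine ⟨insert (D.bag t) 𝓑, .insert _ _ hRI ⟨B', hB', hint⟩, ?_, fun B hB => ?_,
        fun u hu => ?_⟩
      · obtain ⟨v, hvt, hvB'⟩ := Finset.not_subset.1 hsub
        have hv : v ∉ 𝓑.sup id := by
          rw [Finset.mem_sup]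
          rintro ⟨E, hE, hvE⟩
          exact hvB' (hint E hE (Finset.mem_inter.2 ⟨hvt, hvE⟩))
        have hlt : (𝓑.sup id).card < ((insert (D.bag t) 𝓑).sup id).card := by
          refine Finset.card_lt_card ⟨Finset.sup_mono (Finset.subset_insert _ _), fun h => hv (h ?_)⟩
          rw [Finset.mem_sup]
          exact ⟨_, Finset.mem_insert_self _ _, hvt⟩
        have := Finset.card_insert_le (D.bag t) 𝓑
        omega
      · rcases Finset.mem_insert.1 hB with rfl | hB
        · exact ⟨t, Finset.mem_insert_self _ _, rfl⟩
        · obtain ⟨u, hu, rfl⟩ := hbag B hB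
          exact ⟨u, Finset.mem_insert_of_mem hu, rfl⟩
      · rcases Finset.mem_insert.1 hu with rfl | hu
        · exact ⟨_, Finset.mem_insert_self _ _, subset_rfl⟩
        · obtain ⟨B, hB, hBu⟩ := hcov u hu
          exact ⟨B, Finset.mem_insert_of_mem hB, hBu⟩
  exact ht (hmax hgood (Finset.subset_insert _ _) (Finset.mem_insert_self _ _))

/-- The tree-decomposition with a single bag. -/
def TreeDecomposition.trivial {V : Type*} [Fintype V] (G : SimpleGraph V) :
    TreeDecomposition G where
  node := Unit
  fintypeNode := inferInstance
  tree := ⊥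
  isTree := .of_subsingleton
  bag _ := Finset.univ
  vertex_mem_bag _ := ⟨(), Finset.mem_univ _⟩
  edge_mem_bag _ _ _ := ⟨(), Finset.mem_univ _, Finset.mem_univ _⟩
  subtree v :=
    have : Nonempty {_t : Unit | v ∈ (Finset.univ : Finset V)} := ⟨⟨(), Finset.mem_univ _⟩⟩
    { preconnected := .of_subsingleton }

theorem exists_treeDecomposition_card_bag_le {V : Type*} [Fintype V] (G : SimpleGraph V) :
    ∃ D : TreeDecomposition G, ∀ t, (D.bag t).card ≤ treewidth G + 1 := by
  have hne : {w : ℕ | ∃ D : TreeDecomposition G, D.width = w}.Nonempty :=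
    ⟨_, TreeDecomposition.trivial G, rfl⟩
  obtain ⟨D, hD⟩ := Nat.sInf_mem hne
  refine ⟨D, fun t => ?_⟩
  let := D.fintypeNode
  have : (D.bag t).card - 1 ≤ D.width :=
    Finset.le_sup (f := fun t => (D.bag t).card - 1) (Finset.mem_univ t)
  have h2 : D.width = treewidth G := hD
  omega

end Bags

/-! ### The polytope of local marginals -/

section LocalMarginals

variable {V κ : Type*} [Fintype V] [DecidableEq V] {𝓑 : Finset (Finset V)}

/-- Read a vector indexed by the pairs `A ⊆ B ∈ 𝓑` as a function of two arbitrary sets. -/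
def localExtend (e : κ ≃ {q : Finset V × Finset V // q.1 ∈ 𝓑 ∧ q.2 ⊆ q.1}) :
    (κ → ℝ) →ₗ[ℝ] (Finset V → Finset V → ℝ) where
  toFun x B A := if h : B ∈ 𝓑 ∧ A ⊆ B then x (e.symm ⟨(B, A), h⟩) else 0
  map_add' x y := by
    ext B A
    by_cases h : B ∈ 𝓑 ∧ A ⊆ B <;> simp [h]
  map_smul' c x := by
    ext B A
    by_cases h : B ∈ 𝓑 ∧ A ⊆ B <;> simp [h]

/-- The vector of local traces of the set `X`. -/
def localTrace (e : κ ≃ {q : Finset V × Finset V // q.1 ∈ 𝓑 ∧ q.2 ⊆ q.1}) (X : Finset V) :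
    κ → ℝ :=
  fun k => if X ∩ (e k).1.1 = (e k).1.2 then 1 else 0

/-- The polyhedron of consistent families of local probability distributions. -/
def localPolytope (e : κ ≃ {q : Finset V × Finset V // q.1 ∈ 𝓑 ∧ q.2 ⊆ q.1}) : Set (κ → ℝ) :=
  {x | (∀ k, 0 ≤ x k) ∧ (∀ B ∈ 𝓑, ∑ A, localExtend e x B A = 1) ∧
    ∀ B ∈ 𝓑, ∀ B' ∈ 𝓑, ∀ a, ∑ A with A ∩ (B ∩ B') = a, localExtend e x B A
      = ∑ A with A ∩ (B ∩ B') = a, localExtend e x B' A}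

variable (e : κ ≃ {q : Finset V × Finset V // q.1 ∈ 𝓑 ∧ q.2 ⊆ q.1})

omit [Fintype V] in
theorem localExtend_apply (x : κ → ℝ) (k : κ) :
    localExtend e x (e k).1.1 (e k).1.2 = x k := by
  have h := (e k).2
  simp [localExtend, h]

omit [Fintype V] in
theorem localExtend_localTrace {B : Finset V} (hB : B ∈ 𝓑) (X A : Finset V) :
    localExtend e (localTrace e X) B A = if X ∩ B = A then 1 else 0 := by
  by_cases hA : A ⊆ B
  · simp [localExtend, localTrace, hB, hA]
  · have : X ∩ B ≠ A := by
      rintro rfl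
      exact hA Finset.inter_subset_right
    simp [localExtend, hA, this]

/-- Apart from nonnegativity the constraints are affine equations, so `a` and `b` may have any sign.
This serves both convexity and the extension of segments needed for counting facets. -/
theorem localPolytope_combination {x y : κ → ℝ} (hx : x ∈ localPolytope e)
    (hy : y ∈ localPolytope e) {a b : ℝ} (hab : a + b = 1)
    (hpos : ∀ k, 0 ≤ a * x k + b * y k) : a • x + b • y ∈ localPolytope e := by
  refine ⟨fun k => by simpa using hpos k, fun B hB => ?_, fun B hB B' hB' c => ?_⟩
  · simp only [map_add, map_smul, Pi.add_apply, Pi.smul_apply, smul_eq_mul,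
      Finset.sum_add_distrib, ← Finset.mul_sum]
    rw [hx.2.1 B hB, hy.2.1 B hB, mul_one, mul_one, hab]
  · simp only [map_add, map_smul, Pi.add_apply, Pi.smul_apply, smul_eq_mul,
      Finset.sum_add_distrib, ← Finset.mul_sum]
    rw [hx.2.2 B hB B' hB' c, hy.2.2 B hB B' hB' c]

theorem convex_localPolytope : Convex ℝ (localPolytope e) := fun _ hx _ hy _ _ ha hb hab =>
  localPolytope_combination e hx hy hab fun k =>
    add_nonneg (mul_nonneg ha (hx.1 k)) (mul_nonneg hb (hy.1 k))

theorem localTrace_mem (X : Finset V) : localTrace e X ∈ localPolytope e := by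
  refine ⟨fun k => ?_, fun B hB => ?_, fun B hB B' hB' c => ?_⟩
  · unfold localTrace
    split_ifs <;> norm_num
  · simp [localExtend_localTrace e hB]
  · simp only [localExtend_localTrace e hB, localExtend_localTrace e hB', Finset.sum_ite_eq,
      Finset.mem_filter, Finset.mem_univ, true_and, Finset.inter_assoc]
    congr 3
    · ext v
      simp only [Finset.mem_inter]
      tauto

/-- For a family with the running intersection property, local consistency is global. -/
theorem localPolytope_eq_convexHull (h𝓑 : RunningIntersection 𝓑) :
    localPolytope e = convexHull ℝ (Set.range (localTrace e)) := by
  refine Set.Subset.antisymm (fun x hx => ?_) (convexHull_min ?_ (convex_localPolytope e))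
  · obtain ⟨μ, hμ, hμm⟩ := h𝓑.exists_measure (localExtend e x)
      (fun B A => by
        simp only [localExtend, LinearMap.coe_mk, AddHom.coe_mk]
        split_ifs
        exacts [hx.1 _, le_rfl])
      (fun B A h => by
        by_contra hA
        simp [localExtend, hA] at h)
      (fun B hB B' hB' a => by
        simpa only [Finset.sum_filter] using hx.2.2 B hB B' hB' a)
    -- Any one bag fixes the total mass of `μ` to be 1.
    obtain ⟨B, hB⟩ : 𝓑.Nonempty := by
      cases h𝓑 <;> simp
    have hsum : ∑ X, μ X = 1 := by
      rw [← hx.2.1 B hB]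
      simp only [← hμm B hB]
      rw [Finset.sum_comm]
      simp
    have hxe : x = ∑ X, μ X • localTrace e X := by
      ext k
      rw [← localExtend_apply e x k, ← hμm _ (e k).2.1]
      simp [Finset.sum_apply, localTrace]
    rw [hxe]
    exact (convex_convexHull ℝ _).sum_mem (fun X _ => hμ X) hsum fun X _ =>
      subset_convexHull ℝ _ ⟨X, rfl⟩
  · rintro _ ⟨X, rfl⟩
    exact localTrace_mem e X

theorem encard_facets_localPolytope_le [Fintype κ] :
    {F : Set (κ → ℝ) | IsFacet (localPolytope e) F}.encard ≤ Fintype.card κ := by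
  refine encard_facets_le (convex_localPolytope e) (fun x hx => hx.1) fun x hx y hy c hc => ?_
  have : x + c • (x - y) = (1 + c) • x + (-c) • y := by module
  rw [this]
  exact localPolytope_combination e hx hy (by ring) fun k => by linarith [hc k]

/-- The linear map whose coordinates are the probabilities that the random set contains `D j`. -/
def containmentMap {J : Type*} (b D : J → Finset V) : (κ → ℝ) →ₗ[ℝ] (J → ℝ) :=
  LinearMap.pi fun j => ∑ A with D j ⊆ A,
    LinearMap.proj A ∘ₗ LinearMap.proj (φ := fun _ => Finset V → ℝ) (b j) ∘ₗ localExtend e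

theorem containmentMap_localTrace {J : Type*} {b D : J → Finset V} (hb : ∀ j, b j ∈ 𝓑)
    (hD : ∀ j, D j ⊆ b j) (X : Finset V) (j : J) :
    containmentMap e b D (localTrace e X) j = if D j ⊆ X then 1 else 0 := by
  simp [containmentMap, localExtend_localTrace e (hb j), Finset.sum_ite_eq,
    Finset.subset_inter_iff, hD j]

end LocalMarginals

/-! ### Projection onto the correlation polytope -/

section Correlation

variable {V : Type*} [Fintype V] [DecidableEq V] {G : SimpleGraph V}

/-- The set of vertices that a coordinate of the correlation polytope asks for. -/
noncomputable def corSupport (G : SimpleGraph V) : V ⊕ G.edgeSet → Finset V :=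
  Sum.elim (fun v => {v}) fun e => (e : Sym2 V).toFinset

/-- Vertices and edges are treated alike, as containment events that `containmentMap` can read off
from a single bag. -/
theorem corVector_eq_ite (X : Finset V) (j : V ⊕ G.edgeSet) :
    corVector G X j = if corSupport G j ⊆ X then 1 else 0 := by
  classical
  rcases j with v | e
  · simp [corVector, corSupport, Set.indicator_apply]
  · simp [corVector, corSupport, Set.indicator_apply, edgesInside, Finset.subset_iff]

theorem extensionComplexity_correlationPolytope_le {𝓑 : Finset (Finset V)}
    (h𝓑 : RunningIntersection 𝓑) (hcov : ∀ j, ∃ B ∈ 𝓑, corSupport G j ⊆ B) :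
    extensionComplexity (correlationPolytope G) ≤ ((∑ B ∈ 𝓑, 2 ^ B.card : ℕ) : ℕ∞) := by
  classical
  choose b hb hD using hcov
  -- Extensions must live in some `Fin p → ℝ`, so the pairs `A ⊆ B` are numbered.
  let e := (Fintype.equivFin {q : Finset V × Finset V // q.1 ∈ 𝓑 ∧ q.2 ⊆ q.1}).symm
  have hcard : Fintype.card {q : Finset V × Finset V // q.1 ∈ 𝓑 ∧ q.2 ⊆ q.1}
      = ∑ B ∈ 𝓑, 2 ^ B.card := by
    rw [← Finset.sum_congr rfl fun B _ => Finset.card_powerset B, ← Finset.card_sigma,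
      ← Fintype.card_coe]
    exact Fintype.card_congr
      { toFun := fun q => ⟨⟨q.1.1, q.1.2⟩,
          Finset.mem_sigma.2 ⟨q.2.1, Finset.mem_powerset.2 q.2.2⟩⟩
        invFun := fun q => ⟨(q.1.1, q.1.2),
          (Finset.mem_sigma.1 q.2).1, Finset.mem_powerset.1 (Finset.mem_sigma.1 q.2).2⟩
        left_inv := fun q => rfl
        right_inv := fun q => rfl }
  rw [← hcard]
  suffices h : IsExtension (localPolytope e) (correlationPolytope G) from
    le_trans (sInf_le (Set.mem_ofPred.2 ⟨_, localPolytope e, h, rfl⟩))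
      ((encard_facets_localPolytope_le e).trans (by simp))
  refine ⟨⟨_, Set.finite_range _, localPolytope_eq_convexHull e h𝓑⟩,
    (containmentMap e b (corSupport G)).toAffineMap, ?_⟩
  have himage : ∀ X : Finset V, containmentMap e b (corSupport G) (localTrace e X)
      = corVector G X := fun X => by
    ext j
    rw [containmentMap_localTrace e hb hD, corVector_eq_ite]
  rw [localPolytope_eq_convexHull e h𝓑, LinearMap.coe_toAffineMap, LinearMap.image_convexHull,
    correlationPolytope, ← Set.range_comp]
  congr 1
  ext z
  constructor
  · rintro ⟨X, rfl⟩
    exact ⟨X, (himage X).symm⟩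
  · rintro ⟨X, rfl⟩
    exact ⟨X.toFinset, by simp [himage]⟩

end Correlation

/-! ### The final estimate -/

theorem theorem1 :
    ∃ C : ℝ, 0 < C ∧
      ∀ (V : Type*) [Fintype V] (G : SimpleGraph V) (n : ℕ), Fintype.card V = n → 2 ≤ n →
        ∃ k : ℕ, extensionComplexity (correlationPolytope G) = (k : ℕ∞) ∧
          (k : ℝ) ≤ (2 : ℝ) ^ (C * ((treewidth G : ℝ) + Real.logb 2 (n : ℝ))) := by
  -- The exponent 3 comes from `2 * (n + 1) ≤ n ^ 3` for `n ≥ 2`; a square would fail at `n = 2`.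
  refine ⟨3, by norm_num, fun V _ G n hn hn2 => ?_⟩
  classical
  obtain ⟨D, hD⟩ := exists_treeDecomposition_card_bag_le G
  obtain ⟨𝓑, hRI, hcard, hbag, hcov⟩ := D.exists_runningIntersection
  have hcov' : ∀ j, ∃ B ∈ 𝓑, corSupport G j ⊆ B := by
    rintro (v | ⟨e, he⟩)
    · obtain ⟨t, ht⟩ := D.vertex_mem_bag v
      obtain ⟨B, hB, htB⟩ := hcov t
      exact ⟨B, hB, by simpa [corSupport] using htB ht⟩
    · induction e with
      | h u v =>
        obtain ⟨t, hu, hv⟩ := D.edge_mem_bag u v he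
        obtain ⟨B, hB, htB⟩ := hcov t
        refine ⟨B, hB, fun z hz => ?_⟩
        simp only [corSupport, Sum.elim_inr, Sym2.mem_toFinset, Sym2.mem_iff] at hz
        rcases hz with rfl | rfl
        exacts [htB hu, htB hv]
  have hle := extensionComplexity_correlationPolytope_le hRI hcov'
  obtain ⟨k, hk⟩ := ENat.ne_top_iff_exists.1 (ne_top_of_le_ne_top (ENat.natCast_ne_top _) hle)
  refine ⟨k, hk.symm, ?_⟩
  rw [← hk, Nat.cast_le] at hle
  have hkn : k ≤ 2 ^ (3 * treewidth G) * n ^ 3 := by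
    calc k ≤ ∑ B ∈ 𝓑, 2 ^ B.card := hle
      _ ≤ ∑ _B ∈ 𝓑, 2 ^ (treewidth G + 1) := Finset.sum_le_sum fun B hB => by
        obtain ⟨t, rfl⟩ := hbag B hB
        exact Nat.pow_le_pow_right (by norm_num) (hD t)
      _ = 𝓑.card * 2 ^ (treewidth G + 1) := by rw [Finset.sum_const, smul_eq_mul]
      _ ≤ (n + 1) * 2 ^ (treewidth G + 1) := by
        rw [hn] at hcard
        gcongr
      _ = 2 ^ treewidth G * (2 * (n + 1)) := by ring
      _ ≤ 2 ^ (3 * treewidth G) * n ^ 3 := by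
        have h1 : 2 * (n + 1) ≤ n ^ 3 := by nlinarith [sq_nonneg (n - 2), Nat.mul_le_mul hn2 hn2]
        have h2 : treewidth G ≤ 3 * treewidth G := by omega
        gcongr
        norm_num
  calc (k : ℝ) ≤ (2 : ℝ) ^ (3 * treewidth G) * (n : ℝ) ^ 3 := by exact_mod_cast hkn
    _ = (2 : ℝ) ^ (3 * ((treewidth G : ℝ) + Real.logb 2 (n : ℝ))) := by
      have hn0 : (0 : ℝ) < n := by exact_mod_cast (by omega : 0 < n)
      rw [mul_add, Real.rpow_add (by norm_num), mul_comm (3 : ℝ) (Real.logb 2 n),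
        Real.rpow_mul (by norm_num) (Real.logb 2 n), Real.rpow_logb (by norm_num) (by norm_num) hn0]
      norm_cast
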